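/- Let $q>1$. A $q$-expansion of a real number $x$ is a sequence $(d_i)_{i\ge1}$ with $d_i\in\{0,1,q\}$ for all $i$ and $x=\sum_{i=1}^\infty d_i q^{-i}$. For an integer $k\ge1$ let $\mathcal U_q^{(k)}$ be the set of real numbers that have exactly $k$ different $q$-expansions, let $\mathcal U_q=\mathcal U_q^{(1)}$, and let $\mathcal B_k=\{q>1:\mathcal U_q^{(k)}\neq\emptyset\}$. Let $q_c\approx2.32472$ be the unique real root of $x^3-3x^2+2x-1=0$. Then for every integer $k\ge2$ and every $q\in\mathcal B_k$, $$\dim_H\mathcal U_q^{(k)}=\dim_H\mathcal U_q .$$ Moreover, for every real $q>1$, $\dim_H\mathcal U_q>0$ if and only if $q>q_c$. -/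

import Mathlib

namespace MultipleExpansions

/-- `Σ(x)`: the set of all `q`-expansions of `x`, that is, of all sequences with values in the
alphabet `{0, 1, q}` whose associated series in base `q` sums to `x`. Sequences are indexed from
`0`, so the digit `d i` has the weight `q ^ (-(i + 1))`. -/
def expansions (q x : ℝ) : Set (ℕ → ℝ) :=
  {d | (∀ i, d i ∈ ({0, 1, q} : Set ℝ)) ∧ HasSum (fun i => d i / q ^ (i + 1)) x}

/-- `E_q`: the set of real numbers that have a `q`-expansion. -/
def expandable (q : ℝ) : Set ℝ :=
  {x | (expansions q x).Nonempty}

/-- `U_q^(k)`: the set of `x ∈ E_q` that have exactly `k` different `q`-expansions. -/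
def multivoque (q : ℝ) (k : ℕ) : Set ℝ :=
  {x | x ∈ expandable q ∧ (expansions q x).encard = (k : ℕ∞)}

/-- `U_q = U_q^(1)`: the set of `x ∈ E_q` that have a unique `q`-expansion. -/
def univoque (q : ℝ) : Set ℝ :=
  multivoque q 1

/-- `B_k`: the set of bases `q > 1` for which some `x ∈ E_q` has exactly `k` different
`q`-expansions. -/
def bases (k : ℕ) : Set ℝ :=
  {q | 1 < q ∧ (multivoque q k).Nonempty}

/-- The cubic `x ^ 3 - 3 x ^ 2 + 2 x - 1` has exactly one real root. -/
theorem existsUnique_root : ∃! x : ℝ, x ^ 3 - 3 * x ^ 2 + 2 * x - 1 = 0 := by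
  have hc : ContinuousOn (fun x : ℝ => x ^ 3 - 3 * x ^ 2 + 2 * x - 1) (Set.Icc 2 3) := by
    fun_prop
  have h0 : (0 : ℝ) ∈ Set.Icc ((2 : ℝ) ^ 3 - 3 * 2 ^ 2 + 2 * 2 - 1)
      ((3 : ℝ) ^ 3 - 3 * 3 ^ 2 + 2 * 3 - 1) := by
    constructor <;> norm_num
  obtain ⟨x, -, hx⟩ := intermediate_value_Icc (by norm_num : (2 : ℝ) ≤ 3) hc h0
  have hgt : ∀ y : ℝ, y ^ 3 - 3 * y ^ 2 + 2 * y - 1 = 0 → 2 < y := by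
    intro y hy
    by_contra! h
    nlinarith [mul_nonneg (sub_nonneg.2 h) (sq_nonneg (2 * y - 1)), sq_nonneg (2 * y - 1),
      sq_nonneg y]
  refine ⟨x, hx, ?_⟩
  intro y hy
  have hx' : x ^ 3 - 3 * x ^ 2 + 2 * x - 1 = 0 := hx
  have hy' : y ^ 3 - 3 * y ^ 2 + 2 * y - 1 = 0 := hy
  have hx2 := hgt x hx'
  have hy2 := hgt y hy'
  have hprod : (y - x) * (y ^ 2 + y * x + x ^ 2 - 3 * (y + x) + 2) = 0 := by
    linear_combination hy' - hx'
  have hpos : 0 < y ^ 2 + y * x + x ^ 2 - 3 * (y + x) + 2 := by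
    nlinarith [mul_pos (sub_pos.2 hx2) (sub_pos.2 hy2)]
  rcases mul_eq_zero.1 hprod with h | h
  · linarith
  · exact absurd h hpos.ne'

/-- `q_c ≈ 2.32472`: the unique real root of `x ^ 3 - 3 x ^ 2 + 2 x - 1`. -/
noncomputable def criticalBase : ℝ :=
  existsUnique_root.choose

end MultipleExpansions

/-! Splitting by the first digit writes `numExpansions q x` as the sum of its values at `q * x`, `q
* x - 1` and `q * x - q`; everything is read off this recursion.

Upper bound: deleting a suitable finite word turns a point with `k` expansions into one with a
single expansion, so `multivoque q k` lies in countably many affine copies of `univoque q`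
(`mem_hull_univoque`).

The lower bound depends on the sign of `q * (q - 1) * (q - 2) - 1`, the cubic defining
`criticalBase`. If it is nonpositive, only the endpoints `0` and `q / (q - 1)` can have a unique
expansion (`univoque_subset_of_subcritical`), and both dimensions vanish. If it is positive,
`univoque q` is covered by affine copies of `univoqueOne q` and two points. Since the words `0 q`
and `1 0` have equal value, putting `0 q ^ j` in front of a point of `univoqueOne q` produces
exactly `j + 1` expansions (`numExpansions_iterate`), so `multivoque q (j + 1)` contains an affine
copy of `univoqueOne q`. Positivity of the dimension comes from sparse sequences of digits `1` and
`q`, whose values are mapped onto `[0, 1)` by a Hölder map. -/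

namespace MultipleExpansions

open Filter Topology

/-! ### Digit recursion for the number of expansions. -/

/-- A sequence is an expansion of `x` iff its first digit is admissible and its tail is an
expansion of `q * x` minus the first digit. -/
theorem mem_expansions_iff {q x : ℝ} (hq : 1 < q) {d : ℕ → ℝ} :
    d ∈ expansions q x ↔
      d 0 ∈ ({0, 1, q} : Set ℝ) ∧ (fun i => d (i + 1)) ∈ expansions q (q * x - d 0) := by
  have hq0 : q ≠ 0 := by positivity
  have key : HasSum (fun i => d i / q ^ (i + 1)) x ↔
      HasSum (fun i => d (i + 1) / q ^ (i + 1)) (q * x - d 0) := by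
    rw [← hasSum_nat_add_iff' 1, ← hasSum_mul_left_iff hq0]
    have h1 : q * (x - ∑ i ∈ Finset.range 1, d i / q ^ (i + 1)) = q * x - d 0 := by
      simp; field_simp
    have h2 : (fun i => q * (d (i + 1) / q ^ (i + 1 + 1))) = fun i => d (i + 1) / q ^ (i + 1) := by
      funext i; field_simp; ring
    rw [h1, h2]
  simp only [expansions, Set.mem_ofPred_eq, key]
  constructor
  · rintro ⟨h, h'⟩
    exact ⟨h 0, fun i => h _, h'⟩
  · rintro ⟨h, h', h''⟩
    refine ⟨fun i => ?_, h''⟩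
    cases i with
    | zero => exact h
    | succ i => exact h' i

theorem hasSum_div_pow_succ {q : ℝ} (hq : 1 < q) (a : ℝ) :
    HasSum (fun i : ℕ => a / q ^ (i + 1)) (a / (q - 1)) := by
  have h := (hasSum_geometric_of_lt_one (r := q⁻¹) (by positivity)
    (inv_lt_one_of_one_lt₀ hq)).mul_left (a / q)
  have h0 : q ≠ 0 := by positivity
  have h1 : q - 1 ≠ 0 := by linarith
  have h2 : (fun i : ℕ => a / q * q⁻¹ ^ i) = fun i => a / q ^ (i + 1) := by
    funext i
    rw [inv_pow, pow_succ]
    field_simp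
  have h3 : a / q * (1 - q⁻¹)⁻¹ = a / (q - 1) := by
    rw [show 1 - q⁻¹ = (q - 1) / q by field_simp]
    field_simp
  rwa [h2, h3] at h

theorem mem_Icc_of_mem_expansions {q x : ℝ} (hq : 1 < q) {d : ℕ → ℝ} (h : d ∈ expansions q x) :
    x ∈ Set.Icc 0 (q / (q - 1)) := by
  have hq0 : 0 < q := by linarith
  have hd : ∀ i, 0 ≤ d i ∧ d i ≤ q := by
    intro i
    rcases h.1 i with h | h | h <;> rw [h] <;> constructor <;> linarith
  refine ⟨h.2.nonneg fun i => div_nonneg (hd i).1 (by positivity), hasSum_le (fun i => ?_) h.2 (hasSum_div_pow_succ hq q)⟩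
  have := (hd i).2
  gcongr

/-- The number of `q`-expansions of `x`. -/
noncomputable def numExpansions (q x : ℝ) : ℕ∞ := (expansions q x).encard

theorem encard_expansions_head {q x : ℝ} (hq : 1 < q) {a : ℝ} (ha : a ∈ ({0, 1, q} : Set ℝ)) :
    {d ∈ expansions q x | d 0 = a}.encard = numExpansions q (q * x - a) := by
  let f : (ℕ → ℝ) → ℕ → ℝ := fun e n => Nat.casesOn n a e
  have hf : f.Injective := fun e e' h => funext fun i => congrFun h (i + 1)
  rw [numExpansions, ← hf.encard_image (expansions q (q * x - a))]
  congr 1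
  ext d
  constructor
  · intro h
    obtain ⟨h, rfl⟩ : d ∈ expansions q x ∧ d 0 = a := h
    refine ⟨fun i => d (i + 1), ((mem_expansions_iff hq).1 h).2, ?_⟩
    funext i
    cases i <;> rfl
  · intro h
    obtain ⟨e, he, rfl⟩ := h
    exact ⟨(mem_expansions_iff hq).2 ⟨ha, he⟩, rfl⟩

theorem numExpansions_eq_add {q : ℝ} (hq : 1 < q) (x : ℝ) :
    numExpansions q x =
      numExpansions q (q * x) + numExpansions q (q * x - 1) + numExpansions q (q * x - q) := by
  have h0 := encard_expansions_head (x := x) hq (a := 0) (by simp)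
  have h1 := encard_expansions_head (x := x) hq (a := 1) (by simp)
  have h2 := encard_expansions_head (x := x) hq (a := q) (by simp)
  rw [sub_zero] at h0
  rw [← h0, ← h1, ← h2, numExpansions, ← Set.encard_union_eq, ← Set.encard_union_eq]
  · congr 1
    ext d
    constructor
    · intro h
      rcases h.1 0 with h' | h' | h'
      · exact Or.inl (Or.inl ⟨h, h'⟩)
      · exact Or.inl (Or.inr ⟨h, h'⟩)
      · exact Or.inr ⟨h, h'⟩
    · rintro ((h | h) | h) <;> exact h.1
  · rw [Set.disjoint_left]
    rintro d (⟨-, h⟩ | ⟨-, h⟩) ⟨-, h'⟩ <;> linarith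
  · rw [Set.disjoint_left]
    rintro d ⟨-, h⟩ ⟨-, h'⟩
    linarith

theorem numExpansions_sub_le {q : ℝ} (hq : 1 < q) (x : ℝ) {a : ℝ} (ha : a ∈ ({0, 1, q} : Set ℝ)) :
    numExpansions q (q * x - a) ≤ numExpansions q x := by
  rw [← encard_expansions_head hq ha]
  exact Set.encard_le_encard fun d hd => hd.1

theorem numExpansions_sub_add_sub_le {q : ℝ} (hq : 1 < q) (x : ℝ) {a b : ℝ}
    (ha : a ∈ ({0, 1, q} : Set ℝ)) (hb : b ∈ ({0, 1, q} : Set ℝ)) (hab : a ≠ b) :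
    numExpansions q (q * x - a) + numExpansions q (q * x - b) ≤ numExpansions q x := by
  rw [← encard_expansions_head hq ha, ← encard_expansions_head hq hb, ← Set.encard_union_eq]
  · exact Set.encard_le_encard (Set.union_subset (fun d hd => hd.1) fun d hd => hd.1)
  · rw [Set.disjoint_left]
    rintro d ⟨-, h⟩ ⟨-, h'⟩
    exact hab (h.symm.trans h')

theorem mem_Icc_of_numExpansions_ne_zero {q x : ℝ} (hq : 1 < q) (h : numExpansions q x ≠ 0) :
    x ∈ Set.Icc 0 (q / (q - 1)) := by
  obtain ⟨d, hd⟩ := Set.encard_ne_zero.1 h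
  exact mem_Icc_of_mem_expansions hq hd

theorem numExpansions_eq_zero_of_neg {q x : ℝ} (hq : 1 < q) (h : x < 0) :
    numExpansions q x = 0 := by
  by_contra h'
  exact absurd (mem_Icc_of_numExpansions_ne_zero hq h').1 (not_le.2 h)

theorem numExpansions_eq_zero_of_lt {q x : ℝ} (hq : 1 < q) (h : q / (q - 1) < x) :
    numExpansions q x = 0 := by
  by_contra h'
  exact absurd (mem_Icc_of_numExpansions_ne_zero hq h').2 (not_le.2 h)

/-- For `q ^ 2 - 3 * q + 1 ≤ 0` the three branches cover the whole interval, so every point of it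
is expandable. -/
theorem numExpansions_ne_zero {q x : ℝ} (hq : 1 < q) (hq' : q ^ 2 - 3 * q + 1 ≤ 0)
    (hx : x ∈ Set.Icc 0 (q / (q - 1))) : numExpansions q x ≠ 0 := by
  have hq1 : 0 < q - 1 := by linarith
  have step : ∀ y : Set.Icc 0 (q / (q - 1)), ∃ a ∈ ({0, 1, q} : Set ℝ),
      q * (y : ℝ) - a ∈ Set.Icc 0 (q / (q - 1)) := by
    rintro ⟨y, hy0, hy1⟩
    simp only [Set.mem_Icc, le_div_iff₀ hq1] at hy1 ⊢
    -- Greedy choice: the largest digit keeping `q * y - a` nonnegative. For digit `1` the upper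
    -- bound is `q - 1 ≤ q / (q - 1)`, which is `hq'`.
    by_cases h1 : q * y < 1
    · refine ⟨0, by simp, by nlinarith, by nlinarith⟩
    by_cases h2 : y < 1
    · refine ⟨1, by simp, by nlinarith, by nlinarith⟩
    · exact ⟨q, by simp, by nlinarith, by nlinarith⟩
  choose a ha hstep using step
  let T : Set.Icc 0 (q / (q - 1)) → Set.Icc 0 (q / (q - 1)) := fun y => ⟨q * y - a y, hstep y⟩
  let z : ℕ → Set.Icc 0 (q / (q - 1)) := fun n => T^[n] ⟨x, hx⟩
  have hz : ∀ n, (z (n + 1) : ℝ) = q * z n - a (z n) := by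
    intro n
    simp only [z, Function.iterate_succ_apply']
    rfl
  have hsum : ∀ n, ∑ i ∈ Finset.range n, a (z i) / q ^ (i + 1) = x - z n / q ^ n := by
    intro n
    induction n with
    | zero => simp [z]
    | succ n ih =>
      rw [Finset.sum_range_succ, ih, hz]
      field_simp
      ring
  have hlim : Tendsto (fun n => x - (z n : ℝ) / q ^ n) atTop (𝓝 x) := by
    have h0 : Tendsto (fun n => (z n : ℝ) / q ^ n) atTop (𝓝 0) := by
      have h1 : Tendsto (fun n : ℕ => (q / (q - 1)) * (q⁻¹) ^ n) atTop (𝓝 0) := by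
        simpa using (tendsto_pow_atTop_nhds_zero_of_lt_one (by positivity)
          (inv_lt_one_of_one_lt₀ hq)).const_mul (q / (q - 1))
      refine squeeze_zero (fun n => div_nonneg (z n).2.1 (by positivity)) (fun n => ?_) h1
      rw [inv_pow, ← div_eq_mul_inv]
      have := (z n).2.2
      gcongr
    simpa using h0.const_sub x
  refine Set.encard_ne_zero.2 ⟨fun n => a (z n), fun n => ha _, ?_⟩
  rw [hasSum_iff_tendsto_nat_of_nonneg]
  · simpa only [hsum] using hlim
  · intro i
    have : 0 ≤ a (z i) := by
      rcases ha (z i) with h | h | h <;> rw [h] <;> linarith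
    positivity

theorem mem_multivoque_iff {q x : ℝ} {k : ℕ} (hk : k ≠ 0) :
    x ∈ multivoque q k ↔ numExpansions q x = k := by
  refine ⟨fun h => h.2, fun h => ⟨?_, h⟩⟩
  exact Set.encard_ne_zero.1 fun h' => hk <| by simpa [numExpansions, h'] using h.symm

theorem mem_univoque_iff {q x : ℝ} : x ∈ univoque q ↔ numExpansions q x = 1 := by
  rw [univoque, mem_multivoque_iff one_ne_zero, Nat.cast_one]

/-! ### Upper bound through affine copies. -/

/-- The `n`-th stage of the closure of `S` under the maps `x ↦ (x + a) / q`, `a ∈ {0, 1, q}`. -/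
def hullStage (q : ℝ) (S : Set ℝ) : ℕ → Set ℝ
  | 0 => S
  | n + 1 => ⋃ a ∈ ({0, 1, q} : Set ℝ), (fun x => (x + a) / q) '' hullStage q S n

/-- The closure of `S` under the maps `x ↦ (x + a) / q`, `a ∈ {0, 1, q}`. -/
def hull (q : ℝ) (S : Set ℝ) : Set ℝ := ⋃ n, hullStage q S n

theorem subset_hull (q : ℝ) (S : Set ℝ) : S ⊆ hull q S :=
  Set.subset_iUnion (hullStage q S) 0

theorem mem_hull_of_mul_sub_mem {q : ℝ} (hq : 1 < q) {S : Set ℝ} {x a : ℝ}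
    (ha : a ∈ ({0, 1, q} : Set ℝ)) (h : q * x - a ∈ hull q S) : x ∈ hull q S := by
  obtain ⟨n, hn⟩ := Set.mem_iUnion.1 h
  refine Set.mem_iUnion.2 ⟨n + 1, Set.mem_biUnion ha ⟨_, hn, ?_⟩⟩
  have : q ≠ 0 := by positivity
  simp only
  field_simp
  ring

theorem lipschitzWith_affine (b c : ℝ) : LipschitzWith ‖b‖₊ fun x : ℝ => b * x + c := by
  refine LipschitzWith.of_dist_le_mul fun x y => ?_
  simp only [Real.dist_eq, coe_nnnorm, Real.norm_eq_abs]
  rw [← abs_mul]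
  apply le_of_eq
  congr 1
  ring

theorem dimH_hull_le (q : ℝ) (S : Set ℝ) : dimH (hull q S) ≤ dimH S := by
  rw [hull, dimH_iUnion]
  refine iSup_le fun n => ?_
  induction n with
  | zero => exact le_rfl
  | succ n ih =>
    rw [hullStage, dimH_bUnion (Set.toFinite _).countable]
    refine iSup₂_le fun a _ => le_trans ?_ ih
    have : (fun x => (x + a) / q) = fun x => q⁻¹ * x + a / q := by
      funext x
      ring
    rw [this]
    exact (lipschitzWith_affine _ _).dimH_image_le _

/-- A point with finitely many expansions is mapped to a point with a unique expansion by
following a suitable finite word. -/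
theorem mem_hull_univoque {q : ℝ} (hq : 1 < q) (k : ℕ) (hk : k ≠ 0) :
    ∀ x, numExpansions q x = k → x ∈ hull q (univoque q) := by
  induction k using Nat.strong_induction_on with
  | _ k IH =>
  have reduce : ∀ x, numExpansions q x < k → numExpansions q x ≠ 0 →
      x ∈ hull q (univoque q) := by
    intro x hx hx0
    obtain ⟨j, hj⟩ := ENat.ne_top_iff_exists.1 (ne_top_of_lt hx)
    rw [← hj] at hx hx0
    exact IH j (by exact_mod_cast hx) (by exact_mod_cast hx0) x hj.symm
  -- Inner induction on the first place `n` where two expansions differ. At that place both branches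
  -- are nonempty, so each has fewer than `k` expansions.
  have main : ∀ n x, numExpansions q x = k → (∃ d ∈ expansions q x, ∃ e ∈ expansions q x,
      d n ≠ e n ∧ ∀ i < n, d i = e i) → x ∈ hull q (univoque q) := by
    intro n
    induction n with
    | zero =>
      rintro x hx ⟨d, hd, e, he, hne, -⟩
      rw [mem_expansions_iff hq] at hd he
      refine mem_hull_of_mul_sub_mem hq hd.1 (reduce _ ?_ (Set.encard_ne_zero.2 ⟨_, hd.2⟩))
      have h := numExpansions_sub_add_sub_le hq x hd.1 he.1 hne
      have h' : numExpansions q (q * x - e 0) ≠ 0 := Set.encard_ne_zero.2 ⟨_, he.2⟩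
      rw [hx] at h
      obtain ⟨i, hi⟩ := ENat.ne_top_iff_exists.1
        (ne_top_of_le_ne_top (ENat.natCast_ne_top k) (le_self_add.trans h))
      obtain ⟨j, hj⟩ := ENat.ne_top_iff_exists.1
        (ne_top_of_le_ne_top (ENat.natCast_ne_top k) (le_add_self.trans h))
      rw [← hi] at h ⊢
      rw [← hj] at h h'
      norm_cast at h h' ⊢
      omega
    | succ n ih =>
      rintro x hx ⟨d, hd, e, he, hne, heq⟩
      have h0 := heq 0 n.succ_pos
      rw [mem_expansions_iff hq] at hd he
      rw [← h0] at he
      refine mem_hull_of_mul_sub_mem hq hd.1 ?_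
      rcases (numExpansions_sub_le hq x hd.1).lt_or_eq with h | h
      · exact reduce _ (hx ▸ h) (Set.encard_ne_zero.2 ⟨_, hd.2⟩)
      · exact ih _ (h.trans hx) ⟨_, hd.2, _, he.2, hne, fun i hi => heq (i + 1) (by omega)⟩
  intro x hx
  by_cases hk1 : k = 1
  · exact subset_hull _ _ (mem_univoque_iff.2 (by simpa [hk1] using hx))
  have hlt : 1 < (expansions q x).encard := by
    change 1 < numExpansions q x
    rw [hx]
    exact_mod_cast (by omega : 1 < k)
  obtain ⟨d, e, hd, he, hne⟩ := Set.one_lt_encard_iff.1 hlt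
  classical
  have hex : ∃ n, d n ≠ e n := by
    by_contra! h
    exact hne (funext h)
  exact main (Nat.find hex) x hx ⟨d, hd, e, he, Nat.find_spec hex,
    fun i hi => by simpa using Nat.find_min hex hi⟩

theorem dimH_multivoque_le {q : ℝ} (hq : 1 < q) {k : ℕ} (hk : k ≠ 0) :
    dimH (multivoque q k) ≤ dimH (univoque q) :=
  (dimH_mono fun _ hx => mem_hull_univoque hq k hk _ ((mem_multivoque_iff hk).1 hx)).trans
    (dimH_hull_le q _)

/-! ### Structure of unique expansions. -/

/-- A bounded set that is mapped into itself by the expanding map `x ↦ q * x - a` consists at most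
of its fixed point. -/
theorem eq_div_of_mapsTo {q a : ℝ} (hq : 1 < q) {S : Set ℝ} (hS : Bornology.IsBounded S)
    (h : ∀ x ∈ S, q * x - a ∈ S) {x : ℝ} (hx : x ∈ S) : x = a / (q - 1) := by
  have hq1 : q - 1 ≠ 0 := by linarith
  obtain ⟨C, hC⟩ := hS.exists_norm_le
  have hn : ∀ n : ℕ, ∀ x ∈ S, q ^ n * |x - a / (q - 1)| ≤ C + |a / (q - 1)| := by
    intro n
    induction n with
    | zero =>
      intro x hx
      have := hC x hx
      rw [Real.norm_eq_abs] at this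
      simpa using (abs_sub x _).trans (by linarith)
    | succ n ih =>
      intro x hx
      refine le_of_eq_of_le ?_ (ih _ (h x hx))
      have : q * x - a - a / (q - 1) = q * (x - a / (q - 1)) := by
        field_simp
        ring
      rw [this, abs_mul, abs_of_pos (by linarith : 0 < q), pow_succ]
      ring
  by_contra hne
  have hpos : 0 < |x - a / (q - 1)| := abs_pos.2 (sub_ne_zero.2 hne)
  obtain ⟨n, hlt⟩ := pow_unbounded_of_one_lt ((C + |a / (q - 1)|) / |x - a / (q - 1)|) hq
  rw [div_lt_iff₀ hpos] at hlt
  exact absurd (hn n x hx) (not_le.2 hlt)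

theorem exists_digit_of_univoque {q x : ℝ} (hq : 1 < q) (hx : numExpansions q x = 1) :
    ∃ a ∈ ({0, 1, q} : Set ℝ), numExpansions q (q * x - a) = 1 ∧
      ∀ b ∈ ({0, 1, q} : Set ℝ), a ≠ b → numExpansions q (q * x - b) = 0 := by
  obtain ⟨d, hd⟩ := Set.encard_ne_zero.1 (ne_of_eq_of_ne hx one_ne_zero)
  rw [mem_expansions_iff hq] at hd
  have h0 : 1 ≤ numExpansions q (q * x - d 0) :=
    Order.one_le_iff_ne_zero.2 (Set.encard_ne_zero.2 ⟨_, hd.2⟩)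
  have h1 : numExpansions q (q * x - d 0) = 1 :=
    le_antisymm (hx ▸ numExpansions_sub_le hq x hd.1) h0
  refine ⟨d 0, hd.1, h1, fun b hb hne => ?_⟩
  have h := numExpansions_sub_add_sub_le hq x hd.1 hb hne
  rw [hx, h1] at h
  by_contra hb0
  have h2 := add_le_add_right (Order.one_le_iff_ne_zero.2 hb0) 1
  exact absurd (h2.trans h) (by norm_num)

theorem lt_or_lt_of_numExpansions_eq_zero {q x : ℝ} (hq : 1 < q) (hq' : q ^ 2 - 3 * q + 1 ≤ 0)
    (h : numExpansions q x = 0) : x < 0 ∨ q / (q - 1) < x := by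
  by_contra! hx
  exact numExpansions_ne_zero hq hq' hx h

/-- The lexicographic-type description of points with a unique expansion, when the three branches
cover the interval. -/
theorem univoque_cases {q x : ℝ} (hq : 1 < q) (hq' : q ^ 2 - 3 * q + 1 ≤ 0)
    (hx : numExpansions q x = 1) :
    (numExpansions q (q * x) = 1 ∧ q * x < 1) ∨
    (numExpansions q (q * x - 1) = 1 ∧ q / (q - 1) < q * x ∧ q * x < q) ∨
    (numExpansions q (q * x - q) = 1 ∧ q / (q - 1) < q * x - 1) := by
  obtain ⟨a, ha, h1, h⟩ := exists_digit_of_univoque hq hx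
  have hI := mem_Icc_of_numExpansions_ne_zero hq (ne_of_eq_of_ne h1 one_ne_zero)
  obtain ⟨hI0, hI1⟩ := hI
  rcases ha with rfl | rfl | rfl
  · left
    rw [sub_zero] at h1 hI1 hI0
    refine ⟨h1, ?_⟩
    rcases lt_or_lt_of_numExpansions_eq_zero hq hq' (h 1 (by simp) (by norm_num)) with h | h <;>
      linarith
  · right; left
    have h2 := lt_or_lt_of_numExpansions_eq_zero hq hq' (h 0 (by simp) (by norm_num))
    have h3 := lt_or_lt_of_numExpansions_eq_zero hq hq' (h q (by simp) hq.ne)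
    rw [sub_zero] at h2
    refine ⟨h1, ?_, ?_⟩
    · rcases h2 with h | h <;> linarith
    · rcases h3 with h | h <;> linarith
  · right; right
    refine ⟨h1, ?_⟩
    rcases lt_or_lt_of_numExpansions_eq_zero hq hq' (h 1 (by simp) hq.ne') with h | h
    · linarith
    · exact h

/-- The points with a unique expansion, whose first digit is `1`. -/
def univoqueOne (q : ℝ) : Set ℝ := {x | numExpansions q x = 1 ∧ numExpansions q (q * x - 1) = 1}

theorem isBounded_of_forall_numExpansions_ne_zero {q : ℝ} (hq : 1 < q) {S : Set ℝ}
    (h : ∀ x ∈ S, numExpansions q x ≠ 0) : Bornology.IsBounded S :=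
  (Metric.isBounded_Icc 0 (q / (q - 1))).subset
    fun x hx => mem_Icc_of_numExpansions_ne_zero hq (h x hx)

/-! ### At or below the critical base: only the endpoints can be univoque. -/

section Subcritical

variable {q : ℝ}

theorem quadratic_nonpos_of_subcritical (hq : 1 < q) (hc : q * (q - 1) * (q - 2) ≤ 1) :
    q ^ 2 - 3 * q + 1 ≤ 0 := by
  nlinarith

/-- After a first digit `1` the next digit must again be `1`, so the set is invariant under `x ↦ q *
x - 1` and could only contain the fixed point `1 / (q - 1)`. But at that point digit `0` is
admissible too, contradicting uniqueness. -/
theorem univoqueOne_eq_empty (hq : 1 < q) (hc : q * (q - 1) * (q - 2) ≤ 1) :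
    univoqueOne q = ∅ := by
  have hq' := quadratic_nonpos_of_subcritical hq hc
  have hq1 : 0 < q - 1 := by linarith
  have hfac : q * (q - 2) * (q - 1) ≤ 1 := by linarith
  have hle : q * (q - 2) ≤ 1 := by
    by_contra! h
    nlinarith
  have one_lt : ∀ x, numExpansions q x = 1 → numExpansions q (q * x - 1) = 1 →
      q < q * x * (q - 1) ∧ q * x < q := by
    intro x hx hx1
    have hI := mem_Icc_of_numExpansions_ne_zero hq (ne_of_eq_of_ne hx1 one_ne_zero)
    have hmul := numExpansions_sub_add_sub_le hq x (a := 1) (b := 0) (by simp) (by simp)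
      (by norm_num)
    have hmul' := numExpansions_sub_add_sub_le hq x (a := 1) (b := q) (by simp) (by simp)
      hq.ne
    rcases univoque_cases hq hq' hx with ⟨h, h'⟩ | ⟨h, h', h''⟩ | ⟨h, h'⟩
    · rw [sub_zero, hx1, h, hx] at hmul
      exact absurd hmul (by norm_num)
    · rw [div_lt_iff₀ hq1] at h'
      exact ⟨h', h''⟩
    · rw [hx1, h, hx] at hmul'
      exact absurd hmul' (by norm_num)
  have hmaps : ∀ x ∈ univoqueOne q, q * x - 1 ∈ univoqueOne q := by
    rintro x ⟨hx, hx1⟩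
    obtain ⟨hlt, hlt'⟩ := one_lt x hx hx1
    refine ⟨hx1, ?_⟩
    have hy0 : 1 < (q * x - 1) * (q - 1) := by nlinarith
    have hyq : q * x - 1 < q - 1 := by linarith
    generalize q * x - 1 = y at *
    rcases univoque_cases hq hq' hx1 with ⟨h, h'⟩ | ⟨h, h', h''⟩ | ⟨h, h'⟩
    · nlinarith
    · exact h
    · exfalso
      rw [div_lt_iff₀ hq1] at h'
      -- The word `1 q` leaves a tail `z` that no digit can start: `1 ≤ q * z` rules out `0`, while
      -- `z < q * (q - 2) ≤ 1 / (q - 1)` rules out `1`, and `z < 1` rules out `q`.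
      have hz : q * y - q < q * (q - 2) := by nlinarith
      have hzβ : 1 ≤ q * (q * y - q) := by
        have : 3 * q - 1 - q ^ 2 < (q * y - q) * (q - 1) := by nlinarith
        -- This is `hc` rearranged.
        have : q - 1 ≤ q * (3 * q - 1 - q ^ 2) := by nlinarith
        by_contra! hlt
        nlinarith
      generalize q * y - q = z at *
      rcases univoque_cases hq hq' h with ⟨g, g'⟩ | ⟨g, g', g''⟩ | ⟨g, g'⟩
      · linarith
      · rw [div_lt_iff₀ hq1] at g'
        have : 1 < z * (q - 1) := by nlinarith
        nlinarith
      · have := (mem_Icc_of_numExpansions_ne_zero hq (ne_of_eq_of_ne g one_ne_zero)).1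
        nlinarith
  by_contra hne
  obtain ⟨x, hx⟩ := Set.nonempty_iff_ne_empty.2 hne
  have hfix := eq_div_of_mapsTo hq (isBounded_of_forall_numExpansions_ne_zero hq
    fun x hx => ne_of_eq_of_ne hx.1 one_ne_zero) hmaps hx
  have := (one_lt x hx.1 hx.2).1
  rw [hfix] at this
  field_simp at this
  exact lt_irrefl _ this

/-- Digit `1` never occurs, and neither `0 q` nor `q 0` is possible, so a unique expansion is
constantly `0` or constantly `q`. -/
theorem univoque_subset_of_subcritical (hq : 1 < q) (hc : q * (q - 1) * (q - 2) ≤ 1) :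
    univoque q ⊆ {0, q / (q - 1)} := by
  have hq' := quadratic_nonpos_of_subcritical hq hc
  have hq1 : 0 < q - 1 := by linarith
  have hone : ∀ x, numExpansions q x = 1 → numExpansions q (q * x - 1) ≠ 1 := fun x hx hx1 => by
    have : x ∈ univoqueOne q := ⟨hx, hx1⟩
    rwa [univoqueOne_eq_empty hq hc] at this
  intro x hx
  rw [mem_univoque_iff] at hx
  rcases univoque_cases hq hq' hx with ⟨h, h'⟩ | ⟨h, h', h''⟩ | ⟨h, h'⟩
  · left
    have := eq_div_of_mapsTo (a := 0) hq (S := {x | numExpansions q x = 1 ∧ q * x < 1})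
      (isBounded_of_forall_numExpansions_ne_zero hq fun x hx => ne_of_eq_of_ne hx.1 one_ne_zero)
      (fun x ⟨hx, hx1⟩ => ?_) ⟨hx, h'⟩
    · simpa using this
    · rw [sub_zero]
      rcases univoque_cases hq hq' hx with ⟨h, h'⟩ | ⟨h, h', h''⟩ | ⟨h, h'⟩
      · rcases univoque_cases hq hq' h with ⟨g, g'⟩ | ⟨g, g', g''⟩ | ⟨g, g'⟩
        · exact ⟨h, g'⟩
        · exact absurd g (hone _ h)
        · have := (mem_Icc_of_numExpansions_ne_zero hq (ne_of_eq_of_ne g one_ne_zero)).1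
          nlinarith
      · exact absurd h (hone _ hx)
      · have := (mem_Icc_of_numExpansions_ne_zero hq (ne_of_eq_of_ne h one_ne_zero)).1
        linarith
  · exact absurd h (hone _ hx)
  · right
    refine eq_div_of_mapsTo (a := q) hq
      (S := {x | numExpansions q x = 1 ∧ q / (q - 1) < q * x - 1 ∧ numExpansions q (q * x - q) = 1})
      (isBounded_of_forall_numExpansions_ne_zero hq fun x hx => ne_of_eq_of_ne hx.1 one_ne_zero)
      (fun x ⟨hx, hx1, h⟩ => ?_) ⟨hx, h', h⟩
    rcases univoque_cases hq hq' h with ⟨g, g'⟩ | ⟨g, g', g''⟩ | ⟨g, g'⟩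
    · exfalso
      rw [div_lt_iff₀ hq1] at hx1
      have : 3 * q - 1 - q ^ 2 < (q * x - q) * (q - 1) := by nlinarith
      have : q - 1 ≤ q * (3 * q - 1 - q ^ 2) := by nlinarith
      nlinarith
    · exact absurd g (hone _ h)
    · exact ⟨h, g', g⟩

theorem dimH_univoque_of_subcritical (hq : 1 < q) (hc : q * (q - 1) * (q - 2) ≤ 1) :
    dimH (univoque q) = 0 :=
  dimH_countable ((Set.toFinite _).countable.mono (univoque_subset_of_subcritical hq hc))

end Subcritical

/-! ### Reduction to expansions starting with `1`. -/

/-- The blocks `0 q` and `1 0` have the same value, so the first cannot occur in a unique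
expansion. -/
theorem numExpansions_ne_one_of_zero_q {q x : ℝ} (hq : 1 < q)
    (h : numExpansions q (q * (q * x) - q) ≠ 0) : numExpansions q x ≠ 1 := by
  intro hx
  have h0 : numExpansions q (q * x) ≠ 0 := fun h0 =>
    h (le_antisymm (h0 ▸ numExpansions_sub_le hq (q * x) (by simp)) bot_le)
  have h1 : numExpansions q (q * x - 1) ≠ 0 := fun h1 =>
    h (le_antisymm (by
      have := numExpansions_sub_le hq (q * x - 1) (a := 0) (by simp)
      rw [h1, sub_zero, mul_sub, mul_one] at this
      exact this) bot_le)
  have h2 := numExpansions_sub_add_sub_le hq x (a := 0) (b := 1) (by simp) (by simp) (by norm_num)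
  rw [sub_zero, hx] at h2
  have h3 := add_le_add (Order.one_le_iff_ne_zero.2 h0) (Order.one_le_iff_ne_zero.2 h1)
  exact absurd (h3.trans h2) (by norm_num)

/-- A unique expansion without digit `1` avoids `0 q`, hence ends in constant `0` or constant `q`;
otherwise some tail starts with `1`. -/
theorem univoque_subset_hull_univoqueOne {q : ℝ} (hq : 1 < q) :
    univoque q ⊆ hull q (univoqueOne q ∪ {0, q / (q - 1)}) := by
  intro x hx
  rw [mem_univoque_iff] at hx
  set H := hull q (univoqueOne q ∪ {0, q / (q - 1)})
  have hsub : univoqueOne q ∪ {0, q / (q - 1)} ⊆ H := subset_hull _ _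
  by_contra hxH
  have step : ∀ x, numExpansions q x = 1 → x ∉ H →
      (numExpansions q (q * x) = 1 ∧ q * x ∉ H) ∨
      (numExpansions q (q * x - q) = 1 ∧ q * x - q ∉ H) := by
    intro x hx hxH
    obtain ⟨a, ha, h, -⟩ := exists_digit_of_univoque hq hx
    have hH : q * x - a ∉ H := fun h => hxH (mem_hull_of_mul_sub_mem hq ha h)
    rcases ha with rfl | rfl | rfl
    · left
      rw [sub_zero] at h hH
      exact ⟨h, hH⟩
    · exact absurd (hsub (Or.inl ⟨hx, h⟩)) hxH
    · exact Or.inr ⟨h, hH⟩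
  have zero : ∀ x, numExpansions q x = 1 → x ∉ H → numExpansions q (q * x) ≠ 1 := by
    intro x hx hxH h0
    have := eq_div_of_mapsTo (a := 0) hq
      (S := {x | numExpansions q x = 1 ∧ x ∉ H ∧ numExpansions q (q * x) = 1})
      (isBounded_of_forall_numExpansions_ne_zero hq fun x hx => ne_of_eq_of_ne hx.1 one_ne_zero)
      (fun x ⟨hx, hxH, h⟩ => ?_) ⟨hx, hxH, h0⟩
    · exact hxH (hsub (by simp [this]))
    · have hH : q * x ∉ H := fun h =>
        hxH (mem_hull_of_mul_sub_mem hq (a := 0) (by simp) (by rwa [sub_zero]))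
      rw [sub_zero]
      rcases step _ h hH with g | g
      · exact ⟨h, hH, g.1⟩
      · exact absurd hx (numExpansions_ne_one_of_zero_q hq (ne_of_eq_of_ne g.1 one_ne_zero))
  have := eq_div_of_mapsTo (a := q) hq (S := {x | numExpansions q x = 1 ∧ x ∉ H})
    (isBounded_of_forall_numExpansions_ne_zero hq fun x hx => ne_of_eq_of_ne hx.1 one_ne_zero)
    (fun x ⟨hx, hxH⟩ => (step x hx hxH).resolve_left fun h => zero x hx hxH h.1) ⟨hx, hxH⟩
  exact hxH (hsub (by simp [this]))

theorem dimH_univoque_le_univoqueOne {q : ℝ} (hq : 1 < q) :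
    dimH (univoque q) ≤ dimH (univoqueOne q) := by
  refine (dimH_mono (univoque_subset_hull_univoqueOne hq)).trans ((dimH_hull_le q _).trans ?_)
  rw [dimH_union, dimH_finite (Set.toFinite {0, q / (q - 1)})]
  simp

/-! ### Above the critical base: copies of `univoqueOne q` in every `multivoque q k`. -/

section Supercritical

theorem two_lt_of_supercritical {q : ℝ} (hq : 1 < q) (hc : 1 < q * (q - 1) * (q - 2)) : 2 < q := by
  by_contra! h
  nlinarith [mul_nonneg (mul_nonneg (by linarith : 0 ≤ q) (by linarith : 0 ≤ q - 1))
    (by linarith : 0 ≤ 2 - q)]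

theorem endpoint_lt {q : ℝ} (h2 : 2 < q) : q / (q - 1) < q := by
  rw [div_lt_iff₀ (by linarith)]
  nlinarith

/-- If the branches cover the interval, emptiness of the digit `q` branch gives `x < 1`; if they do
not, every point of the digit `1` branch lies below `1`. -/
theorem univoqueOne_bounds {q x : ℝ} (h2 : 2 < q) (hx : x ∈ univoqueOne q) : 1 ≤ q * x ∧ x < 1 := by
  have hq : 1 < q := by linarith
  have hI := mem_Icc_of_numExpansions_ne_zero hq (ne_of_eq_of_ne hx.2 one_ne_zero)
  refine ⟨by linarith [hI.1], ?_⟩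
  by_cases hq' : q ^ 2 - 3 * q + 1 ≤ 0
  · have h := numExpansions_sub_add_sub_le hq x (a := 1) (b := q) (by simp) (by simp) hq.ne
    rw [hx.1, hx.2] at h
    have h0 : numExpansions q (q * x - q) = 0 := by
      by_contra h'
      exact absurd ((add_le_add_right (Order.one_le_iff_ne_zero.2 h') 1).trans h) (by norm_num)
    rcases lt_or_lt_of_numExpansions_eq_zero hq hq' h0 with h | h
    · nlinarith
    · linarith [hI.2]
  · have := hI.2
    rw [le_div_iff₀ (by linarith)] at this
    push Not at hq'
    by_contra! hx1
    nlinarith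

/-- Prepending the digit `q` keeps expansions unique once the point is at least `1 / q`. -/
theorem numExpansions_div_add_one {q x : ℝ} (hq : 1 < q) (hc : 1 < q * (q - 1) * (q - 2))
    (hx : 1 ≤ q * x) : numExpansions q (x / q + 1) = numExpansions q x := by
  have hq1 : 0 < q - 1 := by linarith
  have h1 : q * (x / q + 1) = x + q := by field_simp
  rw [numExpansions_eq_add hq, h1, numExpansions_eq_zero_of_lt hq (x := x + q),
    numExpansions_eq_zero_of_lt hq (x := x + q - 1), zero_add, zero_add, add_sub_cancel_right]
  -- At `x = 1 / q` the tighter condition, `q / (q - 1) < x + q - 1`, is exactly `hc`.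
  all_goals
    rw [div_lt_iff₀ hq1]
    nlinarith

/-- The word `0 q ^ j` followed by `x ∈ univoqueOne q` has exactly `j + 1` expansions. -/
theorem numExpansions_iterate {q x : ℝ} (hq : 1 < q) (hc : 1 < q * (q - 1) * (q - 2))
    (hx : x ∈ univoqueOne q) (j : ℕ) :
    1 ≤ q * ((fun y => y / q + 1)^[j] x) ∧ numExpansions q ((fun y => y / q + 1)^[j] x) = 1 ∧
      numExpansions q ((fun y => y / q + 1)^[j] x / q) = (j + 1 : ℕ) := by
  have h2 := two_lt_of_supercritical hq hc
  have hb := univoqueOne_bounds h2 hx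
  have hq0 : q ≠ 0 := by positivity
  -- For `s = s' / q + 1` the extra term is the count at `s' / q`, because `0 q` and `1 0` agree;
  -- each further `q` thus adds one expansion.
  have key : ∀ s, numExpansions q s = 1 → numExpansions q (s / q) = 1 + numExpansions q (s - 1) := by
    intro s hs
    have hI := mem_Icc_of_numExpansions_ne_zero hq (ne_of_eq_of_ne hs one_ne_zero)
    rw [numExpansions_eq_add hq, mul_div_cancel₀ _ hq0, hs,
      numExpansions_eq_zero_of_neg hq (x := s - q), add_zero]
    linarith [hI.2, endpoint_lt h2]
  induction j with
  | zero =>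
    refine ⟨hb.1, hx.1, ?_⟩
    rw [Function.iterate_zero, id, key x hx.1, numExpansions_eq_zero_of_neg hq (by linarith)]
    simp
  | succ j ih =>
    rw [Function.iterate_succ_apply']
    obtain ⟨ih0, ih1, ih2⟩ := ih
    generalize (fun y => y / q + 1)^[j] x = s at *
    have hs := (numExpansions_div_add_one hq hc ih0).trans ih1
    refine ⟨?_, hs, ?_⟩
    · have : q * (s / q + 1) = s + q := by field_simp
      rw [this]
      have := (mem_Icc_of_numExpansions_ne_zero hq (ne_of_eq_of_ne ih1 one_ne_zero)).1
      linarith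
    · rw [key _ hs, add_sub_cancel_right, ih2]
      push_cast
      ring

theorem dimH_univoque_le_multivoque {q : ℝ} (hq : 1 < q) (hc : 1 < q * (q - 1) * (q - 2)) {k : ℕ}
    (hk : k ≠ 0) : dimH (univoque q) ≤ dimH (multivoque q k) := by
  obtain ⟨j, rfl⟩ := Nat.exists_eq_succ_of_ne_zero hk
  have hq0 : q ≠ 0 := by positivity
  -- `g` deletes a leading `q`, so `g^[j]` after multiplication by `q` deletes `0 q ^ j`, and this
  -- is Lipschitz.
  let g : ℝ → ℝ := fun y => q * y + -q
  have hg : LipschitzWith (‖q‖₊ ^ j) g^[j] := (lipschitzWith_affine q (-q)).iterate j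
  have hg' : LipschitzWith ‖q‖₊ fun y : ℝ => q * y := by
    simpa using lipschitzWith_affine q 0
  have hinv : Function.LeftInverse g fun y => y / q + 1 := by
    intro y
    simp only [g]
    field_simp
    ring
  have hsub : univoqueOne q ⊆ (g^[j] ∘ fun y : ℝ => q * y) '' multivoque q (j + 1) := by
    intro x hx
    refine ⟨(fun y => y / q + 1)^[j] x / q, ?_, ?_⟩
    · exact (mem_multivoque_iff hk).2 (numExpansions_iterate hq hc hx j).2.2
    · simp only [Function.comp_apply]
      rw [mul_div_cancel₀ _ hq0, hinv.iterate j x]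
  exact (dimH_univoque_le_univoqueOne hq).trans
    ((dimH_mono hsub).trans ((hg.comp hg').dimH_image_le _))

end Supercritical

/-! ### A Hölder criterion for positive dimension. -/

/-- If a map `G` onto `[0, 1)` factors in a Hölder way through `Φ`, then the range of `Φ` has
positive Hausdorff dimension. -/
theorem dimH_range_pos_of_holder {Ω : Type*} {Φ G : Ω → ℝ} {C r : ℝ} (hC : 0 ≤ C) (hr : 0 < r)
    (h : ∀ ω ω', |G ω - G ω'| ≤ C * |Φ ω - Φ ω'| ^ r) (hG : Set.Ico 0 1 ⊆ Set.range G) :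
    0 < dimH (Set.range Φ) := by
  classical
  -- The choice of `ω` is harmless: by `h`, equal values of `Φ` force equal values of `G`. The value
  -- `0` off the range plays no role.
  let f : ℝ → ℝ := fun x => if hx : ∃ ω, Φ ω = x then G hx.choose else 0
  have hf : ∀ ω, f (Φ ω) = G ω := by
    intro ω
    have hex : ∃ ω', Φ ω' = Φ ω := ⟨ω, rfl⟩
    have h1 : f (Φ ω) = G hex.choose := dif_pos hex
    have h2 := h hex.choose ω
    rw [hex.choose_spec, sub_self, abs_zero, Real.zero_rpow hr.ne', mul_zero] at h2
    rw [h1]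
    exact sub_eq_zero.1 (abs_eq_zero.1 (le_antisymm h2 (abs_nonneg _)))
  have hol : HolderOnWith C.toNNReal r.toNNReal f (Set.range Φ) := by
    rintro _ ⟨ω, rfl⟩ _ ⟨ω', rfl⟩
    rw [hf, hf, edist_dist, edist_dist, Real.dist_eq, Real.dist_eq, Real.coe_toNNReal _ hr.le,
      ENNReal.ofReal_rpow_of_nonneg (abs_nonneg _) hr.le]
    change _ ≤ ENNReal.ofReal C * _
    rw [← ENNReal.ofReal_mul hC]
    exact ENNReal.ofReal_le_ofReal (h ω ω')
  have him : Set.Ico 0 1 ⊆ f '' Set.range Φ := by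
    intro y hy
    obtain ⟨ω, rfl⟩ := hG hy
    exact ⟨_, ⟨ω, rfl⟩, hf ω⟩
  have h1 : dimH (Set.Ico (0 : ℝ) 1) = 1 := by
    rw [Real.dimH_of_nonempty_interior] <;> simp
  have h2 := (dimH_mono him).trans (hol.dimH_image_le (Real.toNNReal_pos.2 hr))
  rw [h1] at h2
  refine pos_iff_ne_zero.2 fun h0 => ?_
  rw [h0, ENNReal.zero_div] at h2
  exact absurd h2 (by norm_num)

/-! ### Sparse sequences are unique expansions. -/

/-- The value in base `q` of a sequence of digits. -/
noncomputable def value (q : ℝ) (d : ℕ → ℝ) : ℝ := ∑' i, d i / q ^ (i + 1)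

variable {q : ℝ} {d e : ℕ → ℝ}

theorem mem_expansions_value (hq : 1 < q) (hd : ∀ i, d i = 1 ∨ d i = q) :
    d ∈ expansions q (value q d) := by
  refine ⟨fun i => Or.inr (hd i), Summable.hasSum ?_⟩
  refine Summable.of_nonneg_of_le (fun i => ?_) (fun i => ?_) (hasSum_div_pow_succ hq q).summable
  · rcases hd i with h | h <;> rw [h] <;> positivity
  · have : d i ≤ q := by rcases hd i with h | h <;> rw [h]; exact hq.le
    gcongr

theorem value_tail (hq : 1 < q) (hd : ∀ i, d i = 1 ∨ d i = q) :
    value q (fun i => d (i + 1)) = q * value q d - d 0 :=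
  (mem_expansions_value hq fun i => hd (i + 1)).2.unique
    ((mem_expansions_iff hq).1 (mem_expansions_value hq hd)).2.2

theorem value_le (hq : 1 < q) (hd : ∀ i, d i = 1 ∨ d i = q) : value q d ≤ q / (q - 1) :=
  (mem_Icc_of_mem_expansions hq (mem_expansions_value hq hd)).2

theorem le_value (hq : 1 < q) (hd : ∀ i, d i = 1 ∨ d i = q) : 1 / (q - 1) ≤ value q d := by
  refine hasSum_le (fun i => ?_) (hasSum_div_pow_succ hq 1) (mem_expansions_value hq hd).2
  have : 1 ≤ d i := by rcases hd i with h | h <;> rw [h]; exact hq.le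
  gcongr

theorem lt_value (hq : 1 < q) (hd : ∀ i, d i = 1 ∨ d i = q) (h : ∃ i, d i = q) :
    1 / (q - 1) < value q d := by
  obtain ⟨j, hj⟩ := h
  refine hasSum_lt (i := j) (fun i => ?_) ?_ (hasSum_div_pow_succ hq 1)
    (mem_expansions_value hq hd).2
  · have : 1 ≤ d i := by rcases hd i with h | h <;> rw [h]; exact hq.le
    simp only
    gcongr
  · simp only [hj]
    gcongr

theorem value_le_of_prefix (hq : 1 < q) (m : ℕ) : ∀ {d : ℕ → ℝ}, (∀ i, d i = 1 ∨ d i = q) →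
    (∀ i < m, d i = 1) → value q d ≤ 1 / (q - 1) + (q⁻¹) ^ m := by
  have hq1 : q - 1 ≠ 0 := by linarith
  have hq0 : q ≠ 0 := by positivity
  induction m with
  | zero =>
    intro d hd _
    refine (value_le hq hd).trans (le_of_eq ?_)
    field_simp
    ring
  | succ m ih =>
    intro d hd h
    have h1 := ih (fun i => hd (i + 1)) fun i hi => h (i + 1) (by omega)
    rw [value_tail hq hd, h 0 m.succ_pos] at h1
    have h2 : q * (1 / (q - 1) + q⁻¹ ^ (m + 1)) = 1 + (1 / (q - 1) + q⁻¹ ^ m) := by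
      rw [pow_succ]
      field_simp
      ring
    have : q * value q d ≤ q * (1 / (q - 1) + q⁻¹ ^ (m + 1)) := by linarith
    exact le_of_mul_le_mul_left this (by linarith)

/-- Sequences of digits `1` and `q` where every `q` is followed by at least `m` ones and `q`
occurs infinitely often. -/
structure IsSparse (q : ℝ) (m : ℕ) (d : ℕ → ℝ) : Prop where
  digit : ∀ i, d i = 1 ∨ d i = q
  gap : ∀ i, d i = q → ∀ j < m, d (i + 1 + j) = 1
  frequently : ∀ i, ∃ j, d (i + j) = q

theorem IsSparse.tail {m : ℕ} (h : IsSparse q m d) : IsSparse q m fun i => d (i + 1) where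
  digit i := h.digit _
  gap i hi j hj := by
    have := h.gap (i + 1) hi j hj
    rwa [show i + 1 + 1 + j = i + 1 + j + 1 by ring] at this
  frequently i := by
    obtain ⟨j, hj⟩ := h.frequently (i + 1)
    exact ⟨j, by rwa [show i + 1 + j = i + j + 1 by ring] at hj⟩

/-- The critical case is a leading `q`: at least `m` ones follow, so the tail is below `q * (q - 2)`
by `hm`, and `(q + q * (q - 2)) / q = q - 1`. -/
theorem IsSparse.value_lt {m : ℕ} (hq : 1 < q) (hc : 1 < q * (q - 1) * (q - 2))
    (hm : 1 / (q - 1) + (q⁻¹) ^ m < q * (q - 2)) (h : IsSparse q m d) : value q d < q - 1 := by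
  have h2 := two_lt_of_supercritical hq hc
  have ht := value_tail hq h.digit
  rcases h.digit 0 with h0 | h0
  · have h1 := value_le hq h.tail.digit
    rw [ht, h0, le_div_iff₀ (by linarith)] at h1
    by_contra! hle
    have h3 : q * (q - 1) - 1 ≤ q * value q d - 1 := by nlinarith
    have h4 : (q * (q - 1) - 1) * (q - 1) ≤ q := by nlinarith
    nlinarith
  · have h1 := value_le_of_prefix hq m h.tail.digit fun i hi => by
      have := h.gap 0 h0 i hi
      rwa [show 0 + 1 + i = i + 1 by ring] at this
    rw [ht, h0] at h1
    nlinarith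

/-- The tail lies strictly between `1 / (q - 1)` and `q - 1`. The lower bound excludes any smaller
first digit, the upper bound excludes replacing `1` by `q`. -/
theorem IsSparse.digit_zero_eq {m : ℕ} (hq : 1 < q) (hc : 1 < q * (q - 1) * (q - 2))
    (hm : 1 / (q - 1) + (q⁻¹) ^ m < q * (q - 2)) (h : IsSparse q m d)
    (he : e ∈ expansions q (value q d)) : e 0 = d 0 := by
  have h2 := two_lt_of_supercritical hq hc
  have hq1 : 0 < q - 1 := by linarith
  have ht := value_tail hq h.digit
  have hlt := h.tail.value_lt hq hc hm
  have hgt := lt_value hq h.tail.digit (by simpa using h.tail.frequently 0)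
  obtain ⟨he0, he1⟩ := (mem_expansions_iff hq).1 he
  obtain ⟨hI0, hI1⟩ := mem_Icc_of_mem_expansions hq he1
  rw [div_lt_iff₀ hq1] at hgt
  rw [le_div_iff₀ hq1] at hI1
  have hv : q * value q d = value q (fun i => d (i + 1)) + d 0 := by linarith
  rw [hv] at hI0 hI1
  generalize value q (fun i => d (i + 1)) = t at *
  rcases h.digit 0 with h0 | h0 <;> rw [h0] at hI0 hI1 ⊢ <;>
    rcases he0 with h' | h' | h' <;> rw [h'] at hI0 hI1 <;> first | exact h' | (exfalso; nlinarith)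

theorem IsSparse.expansions_value_eq {m : ℕ} (hq : 1 < q) (hc : 1 < q * (q - 1) * (q - 2))
    (hm : 1 / (q - 1) + (q⁻¹) ^ m < q * (q - 2)) (h : IsSparse q m d) :
    expansions q (value q d) = {d} := by
  refine Set.eq_singleton_iff_unique_mem.2 ⟨mem_expansions_value hq h.digit, fun e he => ?_⟩
  have key : ∀ n, ∀ d e : ℕ → ℝ, IsSparse q m d → e ∈ expansions q (value q d) → e n = d n := by
    intro n
    induction n with
    | zero => exact fun d e h he => h.digit_zero_eq hq hc hm he
    | succ n ih =>
      intro d e h he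
      refine ih (fun i => d (i + 1)) (fun i => e (i + 1)) h.tail ?_
      rw [value_tail hq h.digit, ← h.digit_zero_eq hq hc hm he]
      exact ((mem_expansions_iff hq).1 he).2
  exact funext fun n => key n d e h he

/-- At the first disagreement the digits differ by `q - 1`, while the tails differ by at most `q /
(q - 1) - 1 / (q - 1) = 1`. -/
theorem le_pow_mul_value_sub (hq : 1 < q) (N : ℕ) : ∀ {d e : ℕ → ℝ}, (∀ i, d i = 1 ∨ d i = q) →
    (∀ i, e i = 1 ∨ e i = q) → (∀ i < N, d i = e i) → d N = q → e N = 1 →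
    q - 2 ≤ q ^ (N + 1) * (value q d - value q e) := by
  induction N with
  | zero =>
    intro d e hd he _ hdN heN
    have h1 := value_tail hq hd
    have h2 := value_tail hq he
    have h3 := le_value hq fun i => hd (i + 1)
    have h4 := value_le hq fun i => he (i + 1)
    have h5 : q / (q - 1) - 1 / (q - 1) = 1 := by
      have : q - 1 ≠ 0 := by linarith
      field_simp
    rw [hdN] at h1
    rw [heN] at h2
    simp only [zero_add, pow_one]
    linarith
  | succ N ih =>
    intro d e hd he h hdN heN
    have := ih (fun i => hd (i + 1)) (fun i => he (i + 1)) (fun i hi => h (i + 1) (by omega)) hdN heN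
    rw [value_tail hq hd, value_tail hq he, h 0 N.succ_pos] at this
    refine this.trans (le_of_eq ?_)
    ring

/-! ### Block coding and positive dimension. -/

/-- The sequence of blocks of length `2 * m + 2`, each starting with `q` and having in the middle
the digit `q` or `1` according to `ω`. -/
noncomputable def blockSeq (q : ℝ) (m : ℕ) (ω : ℕ → Fin 2) (i : ℕ) : ℝ :=
  if i % (2 * m + 2) = 0 ∨ (i % (2 * m + 2) = m + 1 ∧ ω (i / (2 * m + 2)) = 1) then q else 1

theorem isSparse_blockSeq (hq : 1 < q) (m : ℕ) (ω : ℕ → Fin 2) : IsSparse q m (blockSeq q m ω) where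
  digit i := by
    unfold blockSeq
    split_ifs <;> simp
  gap i hi j hj := by
    have hi' : i % (2 * m + 2) = 0 ∨ i % (2 * m + 2) = m + 1 := by
      unfold blockSeq at hi
      split_ifs at hi with h
      · tauto
      · exact absurd hi hq.ne
    have hr : (i + 1 + j) % (2 * m + 2) = i % (2 * m + 2) + 1 + j := by
      conv_lhs => rw [← Nat.div_add_mod i (2 * m + 2), add_assoc, add_assoc]
      rw [Nat.mul_add_mod, Nat.mod_eq_of_lt (by omega)]
      ring
    unfold blockSeq
    rw [hr, if_neg]
    omega
  frequently i := by
    refine ⟨(2 * m + 1) * i, ?_⟩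
    unfold blockSeq
    rw [if_pos]
    left
    rw [show i + (2 * m + 1) * i = (2 * m + 2) * i by ring, Nat.mul_mod_right]

theorem le_pow_mul_abs_value_blockSeq_sub (h2 : 2 < q) (m : ℕ) {ω ω' : ℕ → Fin 2} {n : ℕ}
    (heq : ∀ i < n, ω i = ω' i) (hne : ω n ≠ ω' n) :
    q - 2 ≤ (q ^ (2 * m + 2)) ^ (n + 1) *
      |value q (blockSeq q m ω) - value q (blockSeq q m ω')| := by
  have hq : 1 < q := by linarith
  wlog hω : ω n = 1 generalizing ω ω'
  · rw [abs_sub_comm]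
    exact this (fun i hi => (heq i hi).symm) hne.symm (by omega)
  have hω' : ω' n ≠ 1 := fun h => hne (hω.trans h.symm)
  have hmod : ((2 * m + 2) * n + (m + 1)) % (2 * m + 2) = m + 1 := by
    rw [Nat.mul_add_mod, Nat.mod_eq_of_lt (by omega)]
  have hdiv : ((2 * m + 2) * n + (m + 1)) / (2 * m + 2) = n := by
    rw [Nat.mul_add_div (by omega), Nat.div_eq_of_lt (by omega), add_zero]
  have h := le_pow_mul_value_sub hq ((2 * m + 2) * n + (m + 1)) (isSparse_blockSeq hq m ω).digit
    (isSparse_blockSeq hq m ω').digit (fun i hi => ?_) ?_ ?_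
  -- The exponent `(2 * m + 2) * n + m + 2` is at most `(2 * m + 2) * (n + 1)`.
  · rw [← pow_mul]
    exact h.trans ((mul_le_mul_of_nonneg_left (le_abs_self _) (by positivity)).trans
      (mul_le_mul_of_nonneg_right (pow_le_pow_right₀ hq.le (by nlinarith)) (abs_nonneg _)))
  · unfold blockSeq
    by_cases hi1 : i % (2 * m + 2) = m + 1
    · have hlt : i / (2 * m + 2) < n := by
        by_contra! hle
        have h1 := Nat.div_add_mod i (2 * m + 2)
        have h2 := Nat.mul_le_mul_left (2 * m + 2) hle
        omega
      rw [heq _ hlt]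
    · simp [hi1]
  · simp [blockSeq, hmod, hdiv, hω]
  · simp [blockSeq, hmod, hdiv, hω']

theorem dimH_univoque_pos (hq : 1 < q) (hc : 1 < q * (q - 1) * (q - 2)) :
    0 < dimH (univoque q) := by
  have h2 := two_lt_of_supercritical hq hc
  have hq1 : 0 < q - 1 := by linarith
  obtain ⟨m, hm⟩ : ∃ m : ℕ, 1 / (q - 1) + (q⁻¹) ^ m < q * (q - 2) := by
    have h0 : 0 < q * (q - 2) - 1 / (q - 1) := by
      rw [sub_pos, div_lt_iff₀ hq1]
      linarith
    obtain ⟨m, hm⟩ := exists_pow_lt_of_lt_one h0 (inv_lt_one_of_one_lt₀ hq)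
    exact ⟨m, by linarith⟩
  have hsub : Set.range (fun ω => value q (blockSeq q m ω)) ⊆ univoque q := by
    rintro _ ⟨ω, rfl⟩
    rw [mem_univoque_iff, numExpansions,
      (isSparse_blockSeq hq m ω).expansions_value_eq hq hc hm, Set.encard_singleton]
  refine lt_of_lt_of_le ?_ (dimH_mono hsub)
  set Q : ℝ := q ^ (2 * m + 2) with hQ
  have hQ1 : 1 < Q := one_lt_pow₀ hq (by omega)
  have hQ0 : 0 < Q := by linarith
  -- Chosen so that `Q ^ r = 2`: separation `(q - 2) / Q ^ (n + 1)` then matches the binary distance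
  -- `2⁻¹ ^ n`, with constant `2 / (q - 2) ^ r`.
  set r : ℝ := Real.log 2 / Real.log Q
  have hlogQ : 0 < Real.log Q := Real.log_pos hQ1
  have hr : 0 < r := div_pos (Real.log_pos (by norm_num)) hlogQ
  have hQr : Q ^ r = 2 := by
    rw [Real.rpow_def_of_pos hQ0, mul_div_cancel₀ _ hlogQ.ne', Real.exp_log (by norm_num)]
  have hq2 : 0 < (q - 2) ^ r := Real.rpow_pos_of_pos (by linarith) r
  refine dimH_range_pos_of_holder (G := Real.ofDigits (b := 2)) (C := 2 / (q - 2) ^ r)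
    (by positivity) hr (fun ω ω' => ?_) fun x hx =>
      ⟨_, Real.ofDigits_digits (b := 2) (by norm_num) hx⟩
  by_cases hωω' : ω = ω'
  · subst hωω'
    simp only [sub_self, abs_zero]
    positivity
  classical
  have hex : ∃ n, ω n ≠ ω' n := by
    by_contra! h
    exact hωω' (funext h)
  obtain ⟨n, hne, heq⟩ : ∃ n, ω n ≠ ω' n ∧ ∀ i < n, ω i = ω' i :=
    ⟨Nat.find hex, Nat.find_spec hex, fun i hi => by simpa using Nat.find_min hex hi⟩
  have h3 := Real.rpow_le_rpow (by linarith) (le_pow_mul_abs_value_blockSeq_sub h2 m heq hne) hr.le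
  rw [← hQ, Real.mul_rpow (by positivity) (abs_nonneg _),
    ← Real.rpow_pow_comm hQ0.le, hQr] at h3
  have h4 := Real.abs_ofDigits_sub_ofDigits_le heq
  refine h4.trans ?_
  rw [div_mul_eq_mul_div, le_div_iff₀ hq2, inv_mul_le_iff₀ (by positivity)]
  refine h3.trans (le_of_eq ?_)
  push_cast
  ring

/-! ### The critical base and the final assembly. -/

theorem criticalBase_lt_iff (hq : 1 < q) : criticalBase < q ↔ 1 < q * (q - 1) * (q - 2) := by
  have hroot : criticalBase ^ 3 - 3 * criticalBase ^ 2 + 2 * criticalBase - 1 = 0 :=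
    existsUnique_root.choose_spec.1
  set c := criticalBase
  have hc2 : 2 < c := by
    by_contra! h
    nlinarith [mul_nonneg (sub_nonneg.2 h) (sq_nonneg (2 * c - 1)), sq_nonneg (2 * c - 1),
      sq_nonneg c]
  constructor
  · intro h
    have : 0 < (q - c) * (q ^ 2 + q * c + c ^ 2 - 3 * (q + c) + 2) :=
      mul_pos (sub_pos.2 h) (by nlinarith [mul_pos (sub_pos.2 hc2) (sub_pos.2 (hc2.trans h))])
    linarith
  · intro h
    have hq2 := two_lt_of_supercritical hq h
    by_contra! hle
    have : 0 ≤ (c - q) * (q ^ 2 + q * c + c ^ 2 - 3 * (q + c) + 2) :=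
      mul_nonneg (sub_nonneg.2 hle) (by nlinarith [mul_pos (sub_pos.2 hc2) (sub_pos.2 hq2)])
    linarith

end MultipleExpansions

theorem theorem1p3 :
    (∀ k : ℕ, 2 ≤ k → ∀ q ∈ MultipleExpansions.bases k,
      dimH (MultipleExpansions.multivoque q k) = dimH (MultipleExpansions.univoque q)) ∧
    (∀ q : ℝ, 1 < q →
      (0 < dimH (MultipleExpansions.univoque q) ↔ MultipleExpansions.criticalBase < q)) := by
  open MultipleExpansions in
  constructor
  · rintro k hk q ⟨hq, -⟩
    have hk0 : k ≠ 0 := by omega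
    refine le_antisymm (dimH_multivoque_le hq hk0) ?_
    rcases le_or_gt (q * (q - 1) * (q - 2)) 1 with hc | hc
    · rw [dimH_univoque_of_subcritical hq hc]
      exact bot_le
    · exact dimH_univoque_le_multivoque hq hc hk0
  · intro q hq
    rw [criticalBase_lt_iff hq]
    refine ⟨fun h => ?_, dimH_univoque_pos hq⟩
    by_contra! hc
    exact h.ne' (dimH_univoque_of_subcritical hq hc)
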